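/- Let $X$ be a covariate with values in a measurable space $\mathcal X$, $Y$ a real-valued outcome and $A$ a treatment with values in a finite set $\mathcal A=\{a_1,\dots,a_d\}$, all defined on a probability space $(\Omega,\mathcal F,\mathbb P)$. Write $e_a(x)=\mathbb P[A=a\mid X=x]$ and fix $1\le\Lambda<\infty$. Let $a\in\mathcal A$ and let $E$ be a random variable on $\Omega$ with $E\in(0,1)$ almost surely such that, almost surely, $$\mathbb E\big[\mathbf 1\{A=a\}/E\,\big|\,X\big]=1$$ and $$\frac{\big(e_a(X)+[1-e_a(X)]/\Lambda\big)\mathbf 1\{A=a\}}{e_a(X)}\le\frac{\mathbf 1\{A=a\}}{E}\le\frac{\big(e_a(X)+[1-e_a(X)]\Lambda\big)\mathbf 1\{A=a\}}{e_a(X)}.$$ Suppose that the probability space carries a random variable $V\sim\mathrm{Uniform}[0,1]$ independent of $(X,Y,A,E)$; this can always be achieved by replacing $\Omega$ with $\Omega\times[0,1]$, where $[0,1]$ carries Lebesgue measure, and by regarding $X,Y,A,E$ as functions on the product. Then there are real random variables $Y(a_1),\dots,Y(a_d)$ and $U$ on the same probability space (respectively, in the second case, on $\Omega\times[0,1]$)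 such that, with $e_a(x,u)=\mathbb P[A=a\mid X=x,U=u]$: 1. $Y=\sum_{j=1}^d\mathbf 1\{A=a_j\}\,Y(a_j)$. 2. The vector $(Y(a_1),\dots,Y(a_d))$ is independent of $A$ conditionally on $(X,U)$, and almost surely $$\frac{e_a(X)}{e_a(X)+[1-e_a(X)]\Lambda}\le e_a(X,U)\le\frac{e_a(X)}{e_a(X)+[1-e_a(X)]/\Lambda}.$$ 3. $\mathbf 1\{A=a\}/e_a(X,U)=\mathbf 1\{A=a\}/E$ almost surely. -/

import Mathlib

open MeasureTheory ProbabilityTheory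

noncomputable section

/-- The indicator `1{A = a}` of a treatment level, as a real random variable. -/
def treatInd {Ω 𝒜 : Type*} (A : Ω → 𝒜) (a : 𝒜) (ω : Ω) : ℝ :=
  (A ⁻¹' {a}).indicator (fun _ => (1 : ℝ)) ω

/-- The propensity score `z ↦ P[A = a | Z = z]` of the level `a` given `Z`, as a function of the
value `z` of `Z`, read off from the regular conditional distribution of `A` given `Z`. With `Z = X`
it is the nominal propensity score `e_a(x)`, with `Z = (X, U)` it is `e_a(x, u)`. -/
def propensity {Ω 𝒜 𝒵 : Type*} [MeasurableSpace Ω] [MeasurableSpace 𝒵]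
    [MeasurableSpace 𝒜] [StandardBorelSpace 𝒜] [Nonempty 𝒜]
    (P : Measure Ω) [IsFiniteMeasure P] (A : Ω → 𝒜) (Z : Ω → 𝒵) (a : 𝒜) (z : 𝒵) : ℝ :=
  (condDistrib A Z P z).real {a}

/-- `f` and `g` are conditionally independent given `Z`: for all events `{f ∈ s}` and `{g ∈ t}`,
`P(f ∈ s, g ∈ t | Z) = P(f ∈ s | Z) P(g ∈ t | Z)` almost surely. (This is `CondIndepFun` without
its assumption that the underlying space is standard Borel.) -/
def CondIndepGiven {Ω β γ 𝒵 : Type*} [MeasurableSpace Ω] [MeasurableSpace β] [MeasurableSpace γ]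
    [MeasurableSpace 𝒵] (P : Measure Ω) (f : Ω → β) (g : Ω → γ) (Z : Ω → 𝒵) : Prop :=
  ∀ (s : Set β) (t : Set γ), MeasurableSet s → MeasurableSet t →
    P⟦f ⁻¹' s ∩ g ⁻¹' t | MeasurableSpace.comap Z inferInstance⟧
      =ᵐ[P] P⟦f ⁻¹' s | MeasurableSpace.comap Z inferInstance⟧
        * P⟦g ⁻¹' t | MeasurableSpace.comap Z inferInstance⟧

/-- `Ypot b` (for `b` in the set `𝒜` of treatment levels) are potential outcomes and `U` is a
confounder, on the probability space of `(X, Y, A, E)`, which are compatible with the observed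
`(X, Y, A)` and with the marginal sensitivity bounds for the level `a`, and whose propensity score
`e_a(X, U)` reproduces the weight `1{A = a} / E`. -/
structure IsConfoundedModel {Ω 𝒳 𝒜 : Type*} [MeasurableSpace Ω] [MeasurableSpace 𝒳]
    [Fintype 𝒜] [MeasurableSpace 𝒜] [StandardBorelSpace 𝒜] [Nonempty 𝒜]
    (P : Measure Ω) [IsFiniteMeasure P] (X : Ω → 𝒳) (Y : Ω → ℝ) (A : Ω → 𝒜) (E : Ω → ℝ)
    (a : 𝒜) (Λ : ℝ) (Ypot : 𝒜 → Ω → ℝ) (U : Ω → ℝ) : Prop where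
  measurable_Ypot : ∀ b, Measurable (Ypot b)
  measurable_U : Measurable U
  /-- `Y = ∑_b 1{A = b} Y(b)`, that is, `Y = Y(A)`. -/
  consistency : ∀ ω, Y ω = ∑ b, treatInd A b ω * Ypot b ω
  /-- The vector `(Y(b))_b` is independent of `A` given `(X, U)`. -/
  condIndep : CondIndepGiven P (fun ω b => Ypot b ω) A (fun ω => (X ω, U ω))
  lower : ∀ᵐ ω ∂P,
    propensity P A X a (X ω)
        / (propensity P A X a (X ω) + (1 - propensity P A X a (X ω)) * Λ)
      ≤ propensity P A (fun ω => (X ω, U ω)) a (X ω, U ω)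
  upper : ∀ᵐ ω ∂P,
    propensity P A (fun ω => (X ω, U ω)) a (X ω, U ω)
      ≤ propensity P A X a (X ω)
        / (propensity P A X a (X ω) + (1 - propensity P A X a (X ω)) / Λ)
  weight : ∀ᵐ ω ∂P,
    treatInd A a ω / propensity P A (fun ω => (X ω, U ω)) a (X ω, U ω) = treatInd A a ω / E ω

end

/-! Let `U` be a real code of R = ((E, Y(a)), Y'), where Y' is the common value of all Y(b) with b ≠
a. Every Y(b) is then a function of `U`, so conditional independence is automatic, and the heart of
the matter is that P[A = a | X, R] is the E-coordinate of R.

On {A = a} the first component is observed and Y' is drawn, given X, from the law of Y on {A ≠ a}.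
On {A ≠ a} the roles are reversed: (E, Y) is drawn, given X, from its law on {A = a} weighted by the
odds (1 - E)/E. The balancing condition says that this weighted law has the same X-marginal as {A ≠
a}. Hence the law of (X, R) on {A ≠ a} is its law on {A = a} weighted by the odds, which is Bayes'
rule for the desired propensity (`exists_coupling_of_balanced`).

The bounds hold on {A = a} by hypothesis; they extend to almost every point because the propensity
given (X, R) is positive. -/

/-! ### Disintegration and coupling of the two arms -/

/-- A finite measure on a product is sampled by drawing the second coordinate as a measurable
function of the first one and of a uniform random variable. -/
theorem exists_uniform_disintegration {𝒳 β : Type*} [MeasurableSpace 𝒳] [MeasurableSpace β]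
    [StandardBorelSpace β] [Nonempty β] (N : Measure (𝒳 × β)) [IsFiniteMeasure N] :
    ∃ f : 𝒳 → unitInterval → β, Measurable (Function.uncurry f) ∧
      ∀ g : 𝒳 × β → ENNReal, Measurable g →
        ∫⁻ z, g z ∂N = ∫⁻ x, (∫⁻ v, g (x, f x v)) ∂N.fst := by
  obtain ⟨f, hf, hκ⟩ := N.condKernel.exists_measurable_map_eq_unitInterval
  refine ⟨f, hf, fun g hg => ?_⟩
  conv_lhs => rw [← N.disintegrate N.condKernel]
  rw [Measure.lintegral_compProd hg]
  refine lintegral_congr fun x => ?_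
  rw [← hκ x, lintegral_map (by fun_prop) hf.of_uncurry_left]

theorem setLIntegral_comp_prodMk_of_indepFun {Ω τ ν : Type*} [MeasurableSpace Ω]
    [MeasurableSpace τ] [MeasurableSpace ν] {P : Measure Ω} [IsProbabilityMeasure P]
    {Q : Measure ν} [SFinite Q] {T : Ω → τ} {V : Ω → ν} (hT : Measurable T) (hV : Measurable V)
    (hVQ : P.map V = Q) (h : IndepFun T V P) {t : Set τ} (ht : MeasurableSet t)
    {g : τ × ν → ENNReal} (hg : Measurable g) :
    ∫⁻ ω in T ⁻¹' t, g (T ω, V ω) ∂P = ∫⁻ ω in T ⁻¹' t, (∫⁻ v, g (T ω, v) ∂Q) ∂P := by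
  have key := h.map_prod_eq_prod_map_map hT.aemeasurable hV.aemeasurable
  rw [hVQ] at key
  have hpre : T ⁻¹' t = (fun ω => (T ω, V ω)) ⁻¹' (t ×ˢ Set.univ) := by ext; simp
  rw [← setLIntegral_map ht hg.lintegral_prod_right' hT, hpre,
    ← setLIntegral_map (ht.prod MeasurableSet.univ) hg (hT.prodMk hV), key,
    ← Measure.prod_restrict, Measure.restrict_univ, lintegral_prod _ hg.aemeasurable]

/-- If weighting `D` by the odds `(1 - p) / p` reproduces the law of `X` on `Dᶜ`, then there is a
variable `R`, extending `B` on `D` and `C` on `Dᶜ`, such that `D` has conditional probability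
`p (R.1)` given `(X, R)`. -/
theorem exists_coupling_of_balanced {Ω 𝒳 𝒜 β γ : Type*} [MeasurableSpace Ω] [MeasurableSpace 𝒳]
    [MeasurableSpace β] [StandardBorelSpace β] [Nonempty β]
    [MeasurableSpace γ] [StandardBorelSpace γ] [Nonempty γ] [MeasurableSpace 𝒜]
    {P : Measure Ω} [IsProbabilityMeasure P] {X : Ω → 𝒳} {B : Ω → β} {C : Ω → γ} {A : Ω → 𝒜} {t : Set 𝒜}
    {V : Ω → unitInterval} (hX : Measurable X) (hB : Measurable B) (hC : Measurable C)
    (hA : Measurable A) (ht : MeasurableSet t) (hV : Measurable V) (hVU : P.map V = volume)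
    (hind : IndepFun (fun ω => (X ω, B ω, C ω, A ω)) V P)
    {p : β → ℝ} (hp : Measurable p) (hp01 : ∀ b, p b ∈ Set.Ioo (0 : ℝ) 1)
    (hbal : ∀ s, MeasurableSet s →
      ∫⁻ ω in X ⁻¹' s ∩ A ⁻¹' t, ENNReal.ofReal (1 / p (B ω)) ∂P = P (X ⁻¹' s)) :
    ∃ R : Ω → β × γ, Measurable R ∧ (∀ ω ∈ A ⁻¹' t, (R ω).1 = B ω) ∧ (∀ ω ∉ A ⁻¹' t, (R ω).2 = C ω) ∧
      ∀ s, MeasurableSet s → P (A ⁻¹' t ∩ (fun ω => (X ω, R ω)) ⁻¹' s)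
        = ∫⁻ ω in (fun ω => (X ω, R ω)) ⁻¹' s, ENNReal.ofReal (p (R ω).1) ∂P := by
  classical
  set D := A ⁻¹' t with hDt
  have hD : MeasurableSet D := hA ht
  let ρ : β → ENNReal := fun b => ENNReal.ofReal ((1 - p b) / p b)
  have hρ : Measurable ρ := by fun_prop
  have hpρ : ∀ b, ENNReal.ofReal (p b) * ρ b = ENNReal.ofReal (1 - p b) := fun b => by
    rw [← ENNReal.ofReal_mul (hp01 b).1.le, mul_div_cancel₀ _ (hp01 b).1.ne']
  have hρ1 : ∀ b, ρ b + 1 = ENNReal.ofReal (1 / p b) := fun b => by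
    have h0 := (hp01 b).1
    have h1 := (hp01 b).2
    rw [← ENNReal.ofReal_one, ← ENNReal.ofReal_add (div_nonneg (by linarith) h0.le) zero_le_one]
    congr 1
    field_simp
    ring
  let N₁ : Measure (𝒳 × β) :=
    ((P.restrict D).withDensity (fun ω => ρ (B ω))).map (fun ω => (X ω, B ω))
  let N₀ : Measure (𝒳 × γ) := (P.restrict Dᶜ).map (fun ω => (X ω, C ω))
  have hN₁ : ∀ g : 𝒳 × β → ENNReal, Measurable g →
      ∫⁻ z, g z ∂N₁ = ∫⁻ ω in D, ρ (B ω) * g (X ω, B ω) ∂P := fun g hg => by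
    rw [lintegral_map hg (by fun_prop),
      lintegral_withDensity_eq_lintegral_mul _ (by fun_prop) (by fun_prop)]
    rfl
  have hN₀ : ∀ g : 𝒳 × γ → ENNReal, Measurable g →
      ∫⁻ z, g z ∂N₀ = ∫⁻ ω in Dᶜ, g (X ω, C ω) ∂P := fun g hg => by
    rw [lintegral_map hg (by fun_prop)]
  have hfst : N₁.fst = N₀.fst := by
    ext s hs
    have e₁ : N₁.fst s = ∫⁻ ω in X ⁻¹' s ∩ D, ρ (B ω) ∂P := by
      rw [Measure.fst_apply hs, Measure.map_apply (by fun_prop) (measurable_fst hs),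
        withDensity_apply _ (by exact hX hs), Measure.restrict_restrict (by exact hX hs)]
      rfl
    have e₀ : N₀.fst s = P (X ⁻¹' s \ D) := by
      rw [Measure.fst_apply hs, Measure.map_apply (by fun_prop) (measurable_fst hs),
        Measure.restrict_apply (by exact hX hs)]
      rfl
    -- Since 1/p = ρ + 1, balance splits into the ρ-mass plus the mass of `D`; cancelling the
    -- latter, which is finite, leaves the mass of `Dᶜ`.
    have h := hbal s hs
    simp_rw [← hρ1] at h
    rw [lintegral_add_right _ measurable_const, setLIntegral_one, ← e₁,
      ← measure_sdiff_add_inter (X ⁻¹' s) hD, ← e₀] at h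
    exact (ENNReal.add_left_inj (measure_ne_top _ _)).1 h
  have : IsFiniteMeasure N₁ := by
    constructor
    rw [← Measure.fst_univ, hfst]
    exact measure_lt_top _ _
  obtain ⟨f₁, hf₁, H₁⟩ := exists_uniform_disintegration N₁
  obtain ⟨f₀, hf₀, H₀⟩ := exists_uniform_disintegration N₀
  have hT : Measurable (fun ω => (X ω, B ω, C ω, A ω)) := by fun_prop
  -- Given X, the observed and the drawn component are independent on either arm. With 1 - p = ρ p,
  -- both sides become the integral of p g over independent draws `f₁ x w`, `f₀ x v`, so Tonelli and
  -- `hfst` conclude.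
  have swap : ∀ g : 𝒳 × β × γ → ENNReal, Measurable g →
      ∫⁻ ω in D, ENNReal.ofReal (1 - p (B ω)) * g (X ω, B ω, f₀ (X ω) (V ω)) ∂P
        = ∫⁻ ω in Dᶜ, ENNReal.ofReal (p (f₁ (X ω) (V ω))) * g (X ω, f₁ (X ω) (V ω), C ω) ∂P := by
    intro g hg
    have mf₁ : Measurable fun z : (𝒳 × γ) × unitInterval => f₁ z.1.1 z.2 :=
      hf₁.comp (measurable_fst.fst.prodMk measurable_snd)
    have mf₀ : Measurable fun z : (𝒳 × β) × unitInterval => f₀ z.1.1 z.2 :=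
      hf₀.comp (measurable_fst.fst.prodMk measurable_snd)
    let h₁ : (𝒳 × β) × unitInterval → ENNReal := fun z =>
      ENNReal.ofReal (p z.1.2) * g (z.1.1, z.1.2, f₀ z.1.1 z.2)
    let h₀ : (𝒳 × γ) × unitInterval → ENNReal := fun z =>
      ENNReal.ofReal (p (f₁ z.1.1 z.2)) * g (z.1.1, f₁ z.1.1 z.2, z.1.2)
    have mh₁ : Measurable h₁ := by fun_prop
    have mh₀ : Measurable h₀ := by fun_prop
    have E₁ : ∫⁻ ω in D, ENNReal.ofReal (1 - p (B ω)) * g (X ω, B ω, f₀ (X ω) (V ω)) ∂P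
        = ∫⁻ x, (∫⁻ w, ∫⁻ v, h₁ ((x, f₁ x w), v)) ∂N₁.fst := by
      rw [← H₁ (fun z => ∫⁻ v, h₁ (z, v)) mh₁.lintegral_prod_right', hN₁ _ mh₁.lintegral_prod_right']
      have := setLIntegral_comp_prodMk_of_indepFun hT hV hVU hind (t := {z | z.2.2.2 ∈ t})
        (measurable_snd.snd.snd ht)
        (g := fun z => ρ z.1.2.1 * h₁ ((z.1.1, z.1.2.1), z.2)) (by fun_prop)
      refine Eq.trans ?_ (this.trans ?_)
      · refine lintegral_congr fun ω => ?_
        simp only [h₁, ← hpρ]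
        ring
      · refine lintegral_congr fun ω => ?_
        exact lintegral_const_mul (ρ (B ω)) (f := fun v => h₁ ((X ω, B ω), v)) (by fun_prop)
    have E₀ : ∫⁻ ω in Dᶜ, ENNReal.ofReal (p (f₁ (X ω) (V ω))) * g (X ω, f₁ (X ω) (V ω), C ω) ∂P
        = ∫⁻ x, (∫⁻ v, ∫⁻ w, h₀ ((x, f₀ x v), w)) ∂N₀.fst := by
      rw [← H₀ (fun z => ∫⁻ w, h₀ (z, w)) mh₀.lintegral_prod_right', hN₀ _ mh₀.lintegral_prod_right']
      exact setLIntegral_comp_prodMk_of_indepFun hT hV hVU hind (t := {z | z.2.2.2 ∈ tᶜ})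
        (measurable_snd.snd.snd ht.compl)
        (g := fun z => h₀ ((z.1.1, z.1.2.2.1), z.2)) (by fun_prop)
    rw [E₁, E₀, hfst]
    refine lintegral_congr fun x => ?_
    have m₁ : Measurable fun z : unitInterval × unitInterval => f₁ x z.1 :=
      hf₁.comp (measurable_const.prodMk measurable_fst)
    have m₀ : Measurable fun z : unitInterval × unitInterval => f₀ x z.2 :=
      hf₀.comp (measurable_const.prodMk measurable_snd)
    exact lintegral_lintegral_swap
      (by simp only [h₁, Function.uncurry_def]; fun_prop)
  have mf₁ : Measurable fun ω => f₁ (X ω) (V ω) := hf₁.comp (hX.prodMk hV)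
  have mf₀ : Measurable fun ω => f₀ (X ω) (V ω) := hf₀.comp (hX.prodMk hV)
  -- Each arm draws only its missing component, so a single `V` serves both.
  let R : Ω → β × γ := fun ω =>
    if ω ∈ D then (B ω, f₀ (X ω) (V ω)) else (f₁ (X ω) (V ω), C ω)
  have hR : Measurable R := Measurable.ite hD (by fun_prop) (by fun_prop)
  have hRD : ∀ ω ∈ D, R ω = (B ω, f₀ (X ω) (V ω)) := fun ω h => if_pos h
  have hRDc : ∀ ω ∉ D, R ω = (f₁ (X ω) (V ω), C ω) := fun ω h => if_neg h
  refine ⟨R, hR, fun ω h => by rw [hRD ω h], fun ω h => by rw [hRDc ω h], fun s hs => ?_⟩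
  have hXR : Measurable fun ω => (X ω, R ω) := by fun_prop
  have mg : Measurable (s.indicator (1 : 𝒳 × β × γ → ENNReal)) := measurable_one.indicator hs
  have hsw := swap _ mg
  have hpre : ∀ ω, ((fun ω => (X ω, R ω)) ⁻¹' s).indicator (1 : Ω → ENNReal) ω
      = s.indicator 1 (X ω, R ω) := fun ω => rfl
  calc P (D ∩ (fun ω => (X ω, R ω)) ⁻¹' s)
      = ∫⁻ ω in D, s.indicator 1 (X ω, R ω) ∂P := by
        simp_rw [← hpre]
        rw [lintegral_indicator_one (hXR hs), Measure.restrict_apply (hXR hs), Set.inter_comm]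
    _ = ∫⁻ ω in D, (ENNReal.ofReal (p (R ω).1) * s.indicator 1 (X ω, R ω)
          + ENNReal.ofReal (1 - p (R ω).1) * s.indicator 1 (X ω, R ω)) ∂P := by
        refine lintegral_congr fun ω => ?_
        rw [← add_mul, ← ENNReal.ofReal_add (hp01 _).1.le (by linarith [(hp01 (R ω).1).2]),
          add_sub_cancel, ENNReal.ofReal_one, one_mul]
    _ = ∫⁻ ω in D, ENNReal.ofReal (p (R ω).1) * s.indicator 1 (X ω, R ω) ∂P
          + ∫⁻ ω in D, ENNReal.ofReal (1 - p (R ω).1) * s.indicator 1 (X ω, R ω) ∂P :=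
        lintegral_add_left (by fun_prop) _
    _ = ∫⁻ ω in D, ENNReal.ofReal (p (R ω).1) * s.indicator 1 (X ω, R ω) ∂P
          + ∫⁻ ω in Dᶜ, ENNReal.ofReal (p (R ω).1) * s.indicator 1 (X ω, R ω) ∂P := by
        congr 1
        refine (setLIntegral_congr_fun hD fun ω h => ?_).trans
          (hsw.trans (setLIntegral_congr_fun hD.compl fun ω h => ?_))
        · simp only [hRD ω h]
        · simp only [hRDc ω h]
    _ = ∫⁻ ω in (fun ω => (X ω, R ω)) ⁻¹' s, ENNReal.ofReal (p (R ω).1) ∂P := by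
        rw [lintegral_add_compl _ hD, ← lintegral_indicator (hXR hs)]
        refine lintegral_congr fun ω => ?_
        by_cases h : (X ω, R ω) ∈ s <;> simp [Set.indicator, h]

/-! ### Propensity scores and conditional expectations -/

theorem measurable_propensity {Ω 𝒜 𝒵 : Type*} [MeasurableSpace Ω] [MeasurableSpace 𝒵]
    [MeasurableSpace 𝒜] [StandardBorelSpace 𝒜] [Nonempty 𝒜]
    (P : Measure Ω) [IsFiniteMeasure P] (A : Ω → 𝒜) (Z : Ω → 𝒵) (a : 𝒜) :
    Measurable (propensity P A Z a) :=
  (Kernel.measurable_coe _ (MeasurableSet.singleton a)).ennreal_toReal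

/-- `condDistrib` depends only on the joint law of (Z, A), so the scores agree as functions, not
merely almost everywhere. -/
theorem propensity_comp_measurePreserving {Ω Ω' 𝒜 𝒵 : Type*} [MeasurableSpace Ω]
    [MeasurableSpace Ω'] [MeasurableSpace 𝒵] [MeasurableSpace 𝒜] [StandardBorelSpace 𝒜]
    [Nonempty 𝒜] {P : Measure Ω} [IsFiniteMeasure P] {P' : Measure Ω'} [IsFiniteMeasure P']
    {π : Ω' → Ω} (hπ : MeasurePreserving π P' P) {A : Ω → 𝒜} {Z : Ω → 𝒵} (hA : Measurable A)
    (hZ : Measurable Z) (a : 𝒜) :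
    propensity P' (fun ω => A (π ω)) (fun ω => Z (π ω)) a = propensity P A Z a := by
  have h : P'.map (fun ω => (Z (π ω), A (π ω))) = P.map (fun ω => (Z ω, A ω)) := by
    conv_rhs => rw [← hπ.map_eq]
    rw [Measure.map_map (hZ.prodMk hA) hπ.measurable]
    rfl
  funext z
  simp only [propensity, condDistrib, h]

/-- The mass of {A = a} where the score vanishes is the integral of the score there. -/
theorem ae_propensity_pos {Ω 𝒜 𝒵 : Type*} [MeasurableSpace Ω] [MeasurableSpace 𝒵]
    [MeasurableSpace 𝒜] [StandardBorelSpace 𝒜] [Nonempty 𝒜]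
    {P : Measure Ω} [IsFiniteMeasure P] {A : Ω → 𝒜} {Z : Ω → 𝒵} (hA : Measurable A)
    (hZ : Measurable Z) (a : 𝒜) : ∀ᵐ ω ∂P, A ω = a → 0 < propensity P A Z a (Z ω) := by
  have hs : MeasurableSet {z | propensity P A Z a z = 0} :=
    measurable_propensity P A Z a (measurableSet_singleton 0)
  have h := setLIntegral_preimage_condDistrib (μ := P) hZ hA.aemeasurable
    (MeasurableSet.singleton a) hs
  rw [setLIntegral_congr_fun (g := fun _ => 0) (hZ hs) fun ω hω =>
    (measureReal_eq_zero_iff).1 hω, lintegral_zero] at h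
  rw [ae_iff]
  refine measure_mono_null (fun ω hω => ?_) h.symm
  simp only [Set.mem_ofPred_eq, Classical.not_imp, not_lt] at hω
  exact ⟨le_antisymm hω.2 measureReal_nonneg, hω.1⟩

theorem setLIntegral_inv_eq_of_condExp_eq_one {Ω 𝒳 𝒜 : Type*} [MeasurableSpace Ω]
    [MeasurableSpace 𝒳] [MeasurableSpace 𝒜] [MeasurableSingletonClass 𝒜]
    {P : Measure Ω} [IsProbabilityMeasure P] {X : Ω → 𝒳} {A : Ω → 𝒜} (hX : Measurable X)
    (hA : Measurable A) {a : 𝒜} {E : Ω → ℝ} (hE01 : ∀ᵐ ω ∂P, E ω ∈ Set.Ioo (0 : ℝ) 1)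
    (hbal : P[fun ω => treatInd A a ω / E ω | MeasurableSpace.comap X inferInstance]
      =ᵐ[P] fun _ => (1 : ℝ)) {s : Set 𝒳} (hs : MeasurableSet s) :
    ∫⁻ ω in X ⁻¹' s ∩ A ⁻¹' {a}, ENNReal.ofReal (1 / E ω) ∂P = P (X ⁻¹' s) := by
  have hAa : MeasurableSet (A ⁻¹' {a}) := hA (MeasurableSet.singleton a)
  -- `condExp` of a nonintegrable function is 0 by convention, so the value 1 forces integrability.
  have hint : Integrable (fun ω => treatInd A a ω / E ω) P := by
    by_contra hn
    rw [condExp_of_not_integrable hn] at hbal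
    obtain ⟨ω, hω⟩ := hbal.exists
    exact zero_ne_one hω
  have hnn : 0 ≤ᵐ[P.restrict (X ⁻¹' s)] fun ω => treatInd A a ω / E ω := by
    filter_upwards [ae_restrict_of_ae hE01] with ω hω
    exact div_nonneg (Set.indicator_nonneg (fun _ _ => zero_le_one) ω) hω.1.le
  have h : ∫ ω in X ⁻¹' s, treatInd A a ω / E ω ∂P = P.real (X ⁻¹' s) := by
    rw [← setIntegral_condExp hX.comap_le hint ⟨s, hs, rfl⟩,
      integral_congr_ae (ae_restrict_of_ae hbal)]
    simp
  rw [Set.inter_comm, ← Measure.restrict_restrict hAa, ← lintegral_indicator hAa]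
  rw [← ofReal_measureReal, ← h, ofReal_integral_eq_lintegral_ofReal hint.integrableOn hnn]
  refine lintegral_congr fun ω => ?_
  by_cases hω : ω ∈ A ⁻¹' {a} <;> simp [treatInd, hω]

/-- The indicator of an event determined by Z pulls out of the conditional expectation. -/
theorem condIndepGiven_of_measurable_comap {Ω β γ 𝒵 : Type*} [MeasurableSpace Ω]
    [MeasurableSpace β] [MeasurableSpace γ] [MeasurableSpace 𝒵] {P : Measure Ω}
    [IsFiniteMeasure P] {f : Ω → β} {g : Ω → γ} {Z : Ω → 𝒵} (hZ : Measurable Z)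
    (hf : Measurable[MeasurableSpace.comap Z inferInstance] f) (hg : Measurable g) :
    CondIndepGiven P f g Z := by
  intro s t hs ht
  have hS := hf hs
  have hS' := hZ.comap_le _ hS
  have hm : StronglyMeasurable[MeasurableSpace.comap Z inferInstance]
      ((f ⁻¹' s).indicator fun _ => (1 : ℝ)) := stronglyMeasurable_const.indicator hS
  have e : (f ⁻¹' s ∩ g ⁻¹' t).indicator (fun _ => (1 : ℝ))
      = (f ⁻¹' s).indicator (fun _ => (1 : ℝ)) * (g ⁻¹' t).indicator (fun _ => (1 : ℝ)) := by
    funext ω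
    by_cases h₁ : ω ∈ f ⁻¹' s <;> by_cases h₂ : ω ∈ g ⁻¹' t <;> simp only [Set.indicator, h₁, h₂,
      Set.mem_inter_iff, Pi.mul_apply, and_self, and_true, and_false, if_true, if_false, mul_one,
      mul_zero]
  have i₂ : Integrable ((g ⁻¹' t).indicator (fun _ => (1 : ℝ))) P :=
    (integrable_const _).indicator (hg ht)
  have i₁ : Integrable ((f ⁻¹' s).indicator (fun _ => (1 : ℝ))
      * (g ⁻¹' t).indicator (fun _ => (1 : ℝ))) P := by
    rw [← e]
    exact (integrable_const _).indicator (hS'.inter (hg ht))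
  rw [e]
  refine (condExp_mul_of_stronglyMeasurable_left hm i₁ i₂).trans ?_
  rw [condExp_of_stronglyMeasurable hZ.comap_le hm ((integrable_const _).indicator hS')]

/-! ### Construction of the confounder -/

theorem isConfoundedModel_of_uniform {Ω 𝒳 𝒜 : Type*} [MeasurableSpace Ω] [MeasurableSpace 𝒳]
    [Fintype 𝒜] [Nonempty 𝒜] [MeasurableSpace 𝒜] [MeasurableSingletonClass 𝒜]
    (P : Measure Ω) [IsProbabilityMeasure P] {X : Ω → 𝒳} {Y : Ω → ℝ} {A : Ω → 𝒜}
    (hX : Measurable X) (hY : Measurable Y) (hA : Measurable A)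
    {Λ : ℝ} (hΛ : 1 ≤ Λ) {a : 𝒜}
    {E : Ω → ℝ} (hE : Measurable E) (hE01 : ∀ᵐ ω ∂P, E ω ∈ Set.Ioo (0 : ℝ) 1)
    (hbal : ∀ s, MeasurableSet s →
      ∫⁻ ω in X ⁻¹' s ∩ A ⁻¹' {a}, ENNReal.ofReal (1 / E ω) ∂P = P (X ⁻¹' s))
    (hlower : ∀ᵐ ω ∂P,
      (propensity P A X a (X ω) + (1 - propensity P A X a (X ω)) / Λ) * treatInd A a ω
          / propensity P A X a (X ω)
        ≤ treatInd A a ω / E ω)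
    (hupper : ∀ᵐ ω ∂P,
      treatInd A a ω / E ω
        ≤ (propensity P A X a (X ω) + (1 - propensity P A X a (X ω)) * Λ) * treatInd A a ω
          / propensity P A X a (X ω))
    {V : Ω → unitInterval} (hV : Measurable V) (hVU : P.map V = volume)
    (hind : IndepFun (fun ω => (X ω, Y ω, A ω, E ω)) V P) :
    ∃ (Ypot : 𝒜 → Ω → ℝ) (U : Ω → ℝ), IsConfoundedModel P X Y A E a Λ Ypot U := by
  classical
  have hAa : MeasurableSet (A ⁻¹' {a}) := hA (MeasurableSet.singleton a)
  have : StandardBorelSpace (Set.Ioo (0 : ℝ) 1) := measurableSet_Ioo.standardBorel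
  have hhalf : (1 / 2 : ℝ) ∈ Set.Ioo (0 : ℝ) 1 := by norm_num
  have : Nonempty (Set.Ioo (0 : ℝ) 1) := ⟨⟨1 / 2, hhalf⟩⟩
  -- The coupling needs p in (0, 1) everywhere, while `E` lies there only almost surely; the
  -- fallback 1/2 is arbitrary.
  let clip : ℝ → Set.Ioo (0 : ℝ) 1 := fun e =>
    ⟨if e ∈ Set.Ioo (0 : ℝ) 1 then e else 1 / 2, by split_ifs with h; exacts [h, hhalf]⟩
  have hclip : Measurable clip :=
    (Measurable.ite measurableSet_Ioo measurable_id measurable_const).subtype_mk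
  have hclipE : ∀ᵐ ω ∂P, (clip (E ω) : ℝ) = E ω := by
    filter_upwards [hE01] with ω hω
    exact if_pos hω
  have hind' : IndepFun (fun ω => (X ω, (clip (E ω), Y ω), Y ω, A ω)) V P :=
    hind.comp (φ := fun z : 𝒳 × ℝ × 𝒜 × ℝ => (z.1, (clip z.2.2.2, z.2.1), z.2.1, z.2.2.1))
      (ψ := id) (by fun_prop) measurable_id
  obtain ⟨R, hR, hRa, hRna, hRP⟩ := exists_coupling_of_balanced hX ((hclip.comp hE).prodMk hY) hY
    hA (MeasurableSet.singleton a) hV hVU hind' (p := fun b => (b.1 : ℝ)) (by fun_prop)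
    (fun b => b.1.2) (fun s hs => by
      rw [← hbal s hs]
      refine lintegral_congr_ae (ae_restrict_of_ae ?_)
      filter_upwards [hclipE] with ω hω
      simp only [Function.comp, hω])
  -- The confounder must be real; an embedding loses no information about `R`.
  let ι := embeddingReal ((Set.Ioo (0 : ℝ) 1 × ℝ) × ℝ)
  have hι : MeasurableEmbedding ι := measurableEmbedding_embeddingReal _
  let Z : Ω → 𝒳 × ℝ := fun ω => (X ω, ι (R ω))
  have hZ : Measurable Z := hX.prodMk (hι.measurable.comp hR)
  have hRZ : Measurable[MeasurableSpace.comap Z inferInstance] R := by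
    have e : R = (fun z : 𝒳 × ℝ => hι.invFun z.2) ∘ Z :=
      funext fun ω => (hι.leftInverse_invFun (R ω)).symm
    rw [e]
    exact (hι.measurable_invFun.comp measurable_snd).comp (comap_measurable Z)
  have hprop : (fun ω => propensity P A Z a (Z ω)) =ᵐ[P] fun ω => ((R ω).1.1 : ℝ) := by
    refine (condDistrib_ae_eq_condExp hZ hA (MeasurableSet.singleton a)).trans ?_
    have hWm : Measurable fun ω => ((R ω).1.1 : ℝ) := by fun_prop
    have hWi : Integrable (fun ω => ((R ω).1.1 : ℝ)) P :=
      Integrable.of_mem_Icc 0 1 hWm.aemeasurable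
        (.of_forall fun ω => Set.Ioo_subset_Icc_self (R ω).1.1.2)
    refine (ae_eq_condExp_of_forall_setIntegral_eq hZ.comap_le
      ((integrable_const _).indicator hAa) (fun _ _ _ => hWi.integrableOn) ?_ ?_).symm
    · rintro _ ⟨s, hs, rfl⟩ -
      have h := hRP ((fun z : 𝒳 × (Set.Ioo (0 : ℝ) 1 × ℝ) × ℝ => (z.1, ι z.2)) ⁻¹' s)
        ((measurable_fst.prodMk (hι.measurable.comp measurable_snd)) hs)
      rw [integral_eq_lintegral_of_nonneg_ae (.of_forall fun ω => (R ω).1.1.2.1.le)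
        hWm.aestronglyMeasurable, setIntegral_indicator hAa, setIntegral_const, smul_eq_mul, mul_one,
        Set.inter_comm, measureReal_def]
      exact congrArg ENNReal.toReal h.symm
    · exact (measurable_subtype_coe.comp
        (measurable_fst.comp (measurable_fst.comp hRZ))).stronglyMeasurable.aestronglyMeasurable
  -- If (X, R) lies outside `s` only off {A = a}, the positive score integrates to 0 over that
  -- event, which is therefore null.
  have hext : ∀ s : Set (𝒳 × (Set.Ioo (0 : ℝ) 1 × ℝ) × ℝ), MeasurableSet s →
      (∀ᵐ ω ∂P, A ω = a → (X ω, R ω) ∈ s) → ∀ᵐ ω ∂P, (X ω, R ω) ∈ s := by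
    intro s hs h
    have h0 : P (A ⁻¹' {a} ∩ (fun ω => (X ω, R ω)) ⁻¹' sᶜ) = 0 := by
      refine measure_mono_null (fun ω hω => ?_) (ae_iff.1 h)
      exact fun hn => hω.2 (hn hω.1)
    rw [hRP _ hs.compl, lintegral_eq_zero_iff (by fun_prop),
      Filter.EventuallyEq, ae_restrict_iff' ((hX.prodMk hR) hs.compl)] at h0
    filter_upwards [h0] with ω hω
    by_contra hn
    exact (ENNReal.ofReal_pos.2 (R ω).1.1.2.1).ne' (hω hn)
  have he := measurable_propensity P A X a
  have he1 : ∀ x, propensity P A X a x ≤ 1 := fun x => measureReal_le_one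
  let Ypot : 𝒜 → Ω → ℝ := fun b ω => if b = a then (R ω).1.2 else (R ω).2
  have hYpot : ∀ b, Measurable[MeasurableSpace.comap Z inferInstance] (Ypot b) := fun b => by
    by_cases hb : b = a
    · simp only [Ypot, if_pos hb]
      exact measurable_snd.comp (measurable_fst.comp hRZ)
    · simp only [Ypot, if_neg hb]
      exact measurable_snd.comp hRZ
  have hYvec : Measurable[MeasurableSpace.comap Z inferInstance] fun ω b => Ypot b ω :=
    @measurable_pi_lambda _ _ _ (MeasurableSpace.comap Z inferInstance) _ _ hYpot
  refine ⟨Ypot, fun ω => ι (R ω), ?_⟩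
  refine ⟨fun b => (hYpot b).mono hZ.comap_le le_rfl, hι.measurable.comp hR, fun ω => ?_,
    condIndepGiven_of_measurable_comap hZ hYvec hA, ?_, ?_, ?_⟩
  · rw [Finset.sum_eq_single (A ω)]
    · by_cases h : A ω = a
      · simp [treatInd, Ypot, h, hRa ω h]
      · simp [treatInd, Ypot, h, hRna ω h]
    · intro b _ hb
      simp [treatInd, Set.indicator, hb.symm]
    · simp
  -- On {A = a} the score coordinate of `R` is `E`, so inverting the bound on 1/E gives this one.
  · have := hext {z | propensity P A X a z.1
        / (propensity P A X a z.1 + (1 - propensity P A X a z.1) * Λ) ≤ z.2.1.1}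
      (measurableSet_le (by fun_prop) (by fun_prop)) (by
        filter_upwards [hupper, hclipE, hE01, ae_propensity_pos hA hX a] with ω h hc h01 hpos hω
        have h0 := hpos hω
        have h1 := he1 (X ω)
        simp only [treatInd, Set.indicator, Set.mem_preimage, Set.mem_singleton_iff, hω, if_true,
          mul_one] at h
        simp only [hRa ω hω, Function.comp, hc]
        rw [div_le_div_iff₀ h01.1 h0] at h
        rw [div_le_iff₀ (by nlinarith)]
        linarith)
    filter_upwards [this, hprop] with ω h hω
    exact h.trans_eq hω.symm
  · have := hext {z | z.2.1.1 ≤ propensity P A X a z.1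
        / (propensity P A X a z.1 + (1 - propensity P A X a z.1) / Λ)}
      (measurableSet_le (by fun_prop) (by fun_prop)) (by
        filter_upwards [hlower, hclipE, hE01, ae_propensity_pos hA hX a] with ω h hc h01 hpos hω
        have h0 := hpos hω
        have h1 : 0 ≤ (1 - propensity P A X a (X ω)) / Λ :=
          div_nonneg (sub_nonneg.2 (he1 (X ω))) (by linarith)
        simp only [treatInd, Set.indicator, Set.mem_preimage, Set.mem_singleton_iff, hω, if_true,
          mul_one] at h
        simp only [hRa ω hω, Function.comp, hc]
        rw [div_le_div_iff₀ h0 h01.1] at h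
        rw [le_div_iff₀ (by linarith)]
        linarith)
    filter_upwards [this, hprop] with ω h hω
    exact hω.trans_le h
  · filter_upwards [hprop, hclipE] with ω hω hc
    by_cases h : A ω = a
    · have hp : propensity P A Z a (Z ω) = E ω := by
        rw [hω, ← hc, hRa ω h]
        rfl
      exact congrArg (treatInd A a ω / ·) hp
    · simp [treatInd, h]

theorem lemmaD1 {Ω 𝒳 𝒜 : Type*} [MeasurableSpace Ω] [MeasurableSpace 𝒳]
    [Fintype 𝒜] [Nonempty 𝒜] [MeasurableSpace 𝒜] [MeasurableSingletonClass 𝒜]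
    (P : Measure Ω) [IsProbabilityMeasure P]
    (X : Ω → 𝒳) (Y : Ω → ℝ) (A : Ω → 𝒜)
    (hX : Measurable X) (hY : Measurable Y) (hA : Measurable A)
    (Λ : ℝ) (hΛ : 1 ≤ Λ) (a : 𝒜)
    (E : Ω → ℝ) (hE : Measurable E) (hE01 : ∀ᵐ ω ∂P, E ω ∈ Set.Ioo (0 : ℝ) 1)
    (hbal : P[fun ω => treatInd A a ω / E ω | MeasurableSpace.comap X inferInstance]
      =ᵐ[P] fun _ => (1 : ℝ))
    (hlower : ∀ᵐ ω ∂P,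
      (propensity P A X a (X ω) + (1 - propensity P A X a (X ω)) / Λ) * treatInd A a ω
          / propensity P A X a (X ω)
        ≤ treatInd A a ω / E ω)
    (hupper : ∀ᵐ ω ∂P,
      treatInd A a ω / E ω
        ≤ (propensity P A X a (X ω) + (1 - propensity P A X a (X ω)) * Λ) * treatInd A a ω
          / propensity P A X a (X ω)) :
    -- on the probability space itself, as soon as it carries a uniform variable independent of
    -- the data
    (∀ V : Ω → unitInterval, Measurable V → P.map V = volume →
        IndepFun (fun ω => (X ω, Y ω, A ω, E ω)) V P →
        ∃ (Ypot : 𝒜 → Ω → ℝ) (U : Ω → ℝ), IsConfoundedModel P X Y A E a Λ Ypot U) ∧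
    -- in general, after adjoining such a variable to the probability space
    (∃ (Ypot : 𝒜 → Ω × unitInterval → ℝ) (U : Ω × unitInterval → ℝ),
        IsConfoundedModel (P.prod (volume : Measure unitInterval))
          (fun ω => X ω.1) (fun ω => Y ω.1) (fun ω => A ω.1) (fun ω => E ω.1) a Λ Ypot U) := by
  have hbal' := fun s (hs : MeasurableSet s) =>
    setLIntegral_inv_eq_of_condExp_eq_one hX hA hE01 hbal hs
  refine ⟨fun V hV hVU hind => isConfoundedModel_of_uniform P hX hY hA hΛ hE hE01 hbal' hlower
    hupper hV hVU hind, ?_⟩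
  have hπ : MeasurePreserving Prod.fst (P.prod (volume : Measure unitInterval)) P :=
    measurePreserving_fst
  have hprop := propensity_comp_measurePreserving hπ hA hX a
  refine isConfoundedModel_of_uniform _ (X := fun ω => X ω.1) (Y := fun ω => Y ω.1)
    (A := fun ω => A ω.1) (E := fun ω => E ω.1) (by fun_prop) (by fun_prop)
    (by fun_prop) hΛ (by fun_prop) (hπ.quasiMeasurePreserving.ae hE01)
    (fun s hs => ?_) ?_ ?_ measurable_snd measurePreserving_snd.map_eq
    (indepFun_prod (X := fun ω => (X ω, Y ω, A ω, E ω)) (Y := id) (by fun_prop) measurable_id)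
  · have hm : MeasurableSet (X ⁻¹' s ∩ A ⁻¹' {a}) := (hX hs).inter (hA (MeasurableSet.singleton a))
    refine (hπ.setLIntegral_comp_preimage hm (f := fun ω => ENNReal.ofReal (1 / E ω))
      (by fun_prop)).trans ((hbal' s hs).trans ?_)
    exact (hπ.measure_preimage (hX hs).nullMeasurableSet).symm
  · rw [hprop]
    exact hπ.quasiMeasurePreserving.ae hlower
  · rw [hprop]
    exact hπ.quasiMeasurePreserving.ae hupper
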